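/- Let $\mathbb{T}$ be the unit circle with normalized arc length measure, and let $L^p=L^p(\mathbb{T})$ be the Lebesgue spaces of complex-valued functions on $\mathbb{T}$. Let $$H^2=\Big\{f\in L^2 : \int_0^{2\pi} f(e^{it})\,e^{-int}\,dt=0 \text{ for every integer } n<0\Big\}$$ be the Hardy space. Let $\varphi$ be a nonzero element of $L^\infty$ (that is, $\varphi$ is not almost everywhere zero). Then the subspace $\varphi H^2=\{\varphi f : f\in H^2\}$ is closed in $L^2$ if and only if $\varphi$ is invertible in the algebra $L^\infty$, that is, there is $\psi\in L^\infty$ with $\varphi\psi=1$ almost everywhere. -/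

import Mathlib

open MeasureTheory AddCircle
open scoped ENNReal Real

instance fact_two_pi_pos : Fact (0 < 2 * π) := ⟨Real.two_pi_pos⟩

/-- The normalized arc length measure `dt / 2π` on the unit circle. The point `e^{it}` of the circle
is represented by the class of `t` in `ℝ / 2πℤ`. -/
noncomputable abbrev circleMeasure : Measure (AddCircle (2 * π)) := haarAddCircle

/-- The Lebesgue space `L^p` of complex-valued functions on the unit circle. -/
noncomputable abbrev LCircle (p : ℝ≥0∞) : AddSubgroup (AddCircle (2 * π) →ₘ[circleMeasure] ℂ) :=
  Lp ℂ p circleMeasure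

/-- The Hardy space `H²`: the functions `f ∈ L²` whose Fourier coefficients
`(1 / 2π) ∫ f(e^{it}) e^{-int} dt` vanish for all integers `n < 0`. -/
noncomputable def hardyH2 : Submodule ℂ (LCircle 2) where
  carrier := {f | ∀ n : ℤ, n < 0 → fourierCoeff f n = 0}
  zero_mem' := by
    intro n _
    rw [← fourierBasis_repr, map_zero]
    rfl
  add_mem' := by
    intro f g hf hg n hn
    have h1 := hf n hn
    have h2 := hg n hn
    rw [← fourierBasis_repr] at h1 h2 ⊢
    rw [map_add, lp.coeFn_add, Pi.add_apply, h1, h2, add_zero]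
  smul_mem' := by
    intro c f hf n hn
    have h1 := hf n hn
    rw [← fourierBasis_repr] at h1 ⊢
    rw [map_smul, lp.coeFn_smul, Pi.smul_apply, h1, smul_zero]

/-- The multiplication operator `M_φ f = φ f` on `L²`, for `φ ∈ L^∞`. -/
noncomputable def mulOp (φ : LCircle ∞) : LCircle 2 →ₗ[ℂ] LCircle 2 where
  toFun f := φ • f
  map_add' f g := Lp.add_smul φ f g
  map_smul' c f := (Lp.smul_comm c φ f).symm

/-- The subspace `φ H² = {φ f : f ∈ H²}` of `L²`. -/
noncomputable def mulHardyH2 (φ : LCircle ∞) : Submodule ℂ (LCircle 2) :=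
  hardyH2.map (mulOp φ)

/-- `φ` is invertible in the (commutative) algebra `L^∞`: there is `ψ ∈ L^∞` with `φ ψ = 1`, the
product being that of classes of almost everywhere equal functions. -/
def IsInvertibleLInfty (φ : LCircle ∞) : Prop :=
  ∃ ψ : LCircle ∞, (φ : AddCircle (2 * π) →ₘ[circleMeasure] ℂ) * ψ = 1

/-! If `φψ = 1`, then `φH²` is the preimage of the closed space `H²` under multiplication by `ψ`.
Conversely, `M_φ` is injective on `H²`, so a closed range makes it bounded below there. Shifts are
isometries commuting with `M_φ` and carry every trigonometric polynomial into `H²`; by density the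
bound holds on `L²`, and indicators then bound `|φ|` below.

Injectivity (`eq_zero_of_mulOp_eq_zero`) is a wandering vector argument. If `M = H² ∩ ker M_φ` is
nonzero, this closed shift-invariant space contains some `h ≠ 0` orthogonal to its positive shifts.
The nonzero Fourier coefficients of `|h|²` vanish, so `|h|` is a.e. a nonzero constant, and `φh = 0`
forces `φ = 0`. -/

theorem coeFn_mulOp (φ : LCircle ∞) (f : LCircle 2) :
    mulOp φ f =ᵐ[circleMeasure] fun x => φ x * f x :=
  Lp.coeFn_lpSMul φ f

theorem norm_mulOp_le (φ : LCircle ∞) (f : LCircle 2) : ‖mulOp φ f‖ ≤ ‖φ‖ * ‖f‖ :=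
  Lp.norm_smul_le φ f

theorem continuous_mulOp (φ : LCircle ∞) : Continuous (mulOp φ) :=
  AddMonoidHomClass.continuous_of_bound (mulOp φ) ‖φ‖ (norm_mulOp_le φ)

theorem mulOp_comm (φ ψ : LCircle ∞) (f : LCircle 2) :
    mulOp φ (mulOp ψ f) = mulOp ψ (mulOp φ f) := by
  apply Lp.ext
  filter_upwards [coeFn_mulOp φ (mulOp ψ f), coeFn_mulOp ψ (mulOp φ f), coeFn_mulOp φ f,
    coeFn_mulOp ψ f] with x h1 h2 h3 h4
  rw [h1, h2, h3, h4]
  ring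

theorem coeFn_mulOp_fourierLp (k : ℤ) (f : LCircle 2) :
    mulOp (fourierLp ∞ k) f =ᵐ[circleMeasure] fun x => fourier k x * f x := by
  filter_upwards [coeFn_mulOp (fourierLp ∞ k) f, coeFn_fourierLp (T := 2 * π) ∞ k] with x h1 h2
  rw [h1, h2]

theorem norm_mulOp_fourierLp (k : ℤ) (f : LCircle 2) : ‖mulOp (fourierLp ∞ k) f‖ = ‖f‖ := by
  have h : ∀ᵐ x ∂circleMeasure, ‖mulOp (fourierLp ∞ k) f x‖ = ‖f x‖ := by
    filter_upwards [coeFn_mulOp_fourierLp k f] with x hx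
    rw [hx, norm_mul, fourier_apply, Circle.norm_coe, one_mul]
  exact le_antisymm (Lp.norm_le_norm_of_ae_le (h.mono fun _ hx => hx.le))
    (Lp.norm_le_norm_of_ae_le (h.mono fun _ hx => hx.ge))

theorem fourierCoeff_mulOp_fourierLp (k : ℤ) (f : LCircle 2) (n : ℤ) :
    fourierCoeff (mulOp (fourierLp ∞ k) f) n = fourierCoeff f (n - k) := by
  apply integral_congr_ae
  filter_upwards [coeFn_mulOp_fourierLp k f] with x hx
  simp only [smul_eq_mul]
  rw [hx, ← mul_assoc, ← fourier_add, show -n + k = -(n - k) by ring]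

theorem fourierCoeff_eq_inner (f : LCircle 2) (n : ℤ) :
    fourierCoeff f n = inner ℂ (fourierLp 2 n : LCircle 2) f := by
  rw [← fourierBasis_repr, fourierBasis.repr_apply_apply, coe_fourierBasis]

theorem continuous_fourierCoeff (n : ℤ) : Continuous fun f : LCircle 2 => fourierCoeff f n := by
  simp_rw [fourierCoeff_eq_inner]
  fun_prop

theorem eq_zero_of_fourierCoeff_eq_zero {f : LCircle 2} (h : ∀ n, fourierCoeff f n = 0) :
    f = 0 := by
  have := hasSum_fourier_series_L2 f
  simp only [h, zero_smul] at this
  exact this.unique hasSum_zero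

theorem isClosed_hardyH2 : IsClosed (hardyH2 : Set (LCircle 2)) := by
  have : (hardyH2 : Set (LCircle 2)) = ⋂ n : ℤ, ⋂ _ : n < 0, {f : LCircle 2 | fourierCoeff f n = 0} := by
    ext f
    simp only [Set.mem_iInter]
    rfl
  rw [this]
  exact isClosed_iInter fun n => isClosed_iInter fun _ =>
    isClosed_eq (continuous_fourierCoeff n) continuous_const

theorem mulOp_fourierLp_mem_hardyH2 {f : LCircle 2} (hf : f ∈ hardyH2) {k : ℤ} (hk : 0 ≤ k) :
    mulOp (fourierLp ∞ k) f ∈ hardyH2 := by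
  intro n hn
  rw [fourierCoeff_mulOp_fourierLp]
  exact hf _ (by lia)

/-! ### Functions with vanishing nonzero Fourier coefficients -/

theorem integrable_continuousMap_mul {w : AddCircle (2 * π) → ℂ} (hw : Integrable w circleMeasure)
    (g : C(AddCircle (2 * π), ℂ)) : Integrable (fun x => g x * w x) circleMeasure :=
  hw.bdd_mul g.continuous.aestronglyMeasurable (ae_of_all _ g.norm_coe_le_norm)

theorem continuous_integral_continuousMap_mul {w : AddCircle (2 * π) → ℂ}
    (hw : Integrable w circleMeasure) :
    Continuous fun g : C(AddCircle (2 * π), ℂ) => ∫ x, g x * w x ∂circleMeasure := by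
  refine continuous_iff_continuousAt.2 fun g₀ => ?_
  refine continuousAt_of_dominated (bound := fun x => (‖g₀‖ + 1) * ‖w x‖)
    (.of_forall fun g => (integrable_continuousMap_mul hw g).aestronglyMeasurable) ?_
    (hw.norm.const_mul _) (ae_of_all _ fun x => ?_)
  · have : ∀ᶠ g : C(AddCircle (2 * π), ℂ) in nhds g₀, ‖g‖ < ‖g₀‖ + 1 :=
      continuous_norm.continuousAt.eventually_lt continuousAt_const (by simp)
    filter_upwards [this] with g hg
    refine ae_of_all _ fun x => ?_
    rw [norm_mul]
    gcongr
    exact (g.norm_coe_le_norm x).trans hg.le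
  · exact ((continuous_eval_const x).mul continuous_const).continuousAt

/-- An integrable function whose nonzero Fourier coefficients vanish integrates continuous functions
like the constant given by its mean. -/
theorem integral_continuousMap_mul_eq {w : AddCircle (2 * π) → ℂ}
    (hw : Integrable w circleMeasure)
    (h : ∀ k : ℤ, k ≠ 0 → ∫ x, fourier k x * w x ∂circleMeasure = 0)
    (g : C(AddCircle (2 * π), ℂ)) :
    ∫ x, g x * w x ∂circleMeasure = (∫ x, w x ∂circleMeasure) * ∫ x, g x ∂circleMeasure := by
  have hone : Integrable (fun _ : AddCircle (2 * π) => (1 : ℂ)) circleMeasure :=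
    integrable_const 1
  have hgint : ∀ g : C(AddCircle (2 * π), ℂ), Integrable g circleMeasure := fun g => by
    simpa using integrable_continuousMap_mul hone g
  have hgcont : Continuous fun g : C(AddCircle (2 * π), ℂ) => ∫ x, g x ∂circleMeasure := by
    simpa using continuous_integral_continuousMap_mul hone
  have hg : g ∈ (Submodule.span ℂ (Set.range (fourier (T := 2 * π)))).topologicalClosure := by
    rw [span_fourier_closure_eq_top]; trivial
  refine closure_minimal (t := {g : C(AddCircle (2 * π), ℂ) | ∫ x, g x * w x ∂circleMeasure =
    (∫ x, w x ∂circleMeasure) * ∫ x, g x ∂circleMeasure}) ?_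
    (isClosed_eq (continuous_integral_continuousMap_mul hw) (continuous_const.mul hgcont)) hg
  intro g hg
  induction hg using Submodule.span_induction with
  | mem g hg =>
    obtain ⟨k, rfl⟩ := hg
    rcases eq_or_ne k 0 with rfl | hk
    · simp
    · have h0 := fourierCoeff_fourier (T := 2 * π) k
      have h1 : ∫ x, fourier k x ∂circleMeasure = fourierCoeff (fourier (T := 2 * π) k) 0 := by
        simp [fourierCoeff]
      rw [Set.mem_ofPred_eq, h k hk, h1, h0, Pi.single_eq_of_ne hk.symm, mul_zero]
  | zero => simp
  | add f g _ _ hf hg =>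
    simp only [Set.mem_ofPred_eq, ContinuousMap.add_apply, add_mul] at hf hg ⊢
    rw [integral_add (integrable_continuousMap_mul hw f) (integrable_continuousMap_mul hw g),
      integral_add (hgint f) (hgint g), hf, hg, mul_add]
  | smul a f _ hf =>
    simp only [Set.mem_ofPred_eq, ContinuousMap.smul_apply, smul_eq_mul, mul_assoc] at hf ⊢
    rw [integral_const_mul, integral_const_mul, hf]
    ring

/-- A nonnegative integrable function whose nonzero Fourier coefficients vanish is almost everywhere
zero or almost everywhere nonzero. -/
theorem ae_eq_zero_or_ae_ne_zero {w : AddCircle (2 * π) → NNReal} (hmeas : Measurable w)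
    (hint : Integrable (fun x => (w x : ℝ)) circleMeasure)
    (h : ∀ k : ℤ, k ≠ 0 → ∫ x, fourier k x * ((w x : ℝ) : ℂ) ∂circleMeasure = 0) :
    (∀ᵐ x ∂circleMeasure, w x = 0) ∨ ∀ᵐ x ∂circleMeasure, w x ≠ 0 := by
  obtain ⟨c, hc⟩ : ∃ c : NNReal, (c : ℝ) = ∫ x, (w x : ℝ) ∂circleMeasure :=
    ⟨⟨_, integral_nonneg fun x => (w x).2⟩, rfl⟩
  rcases eq_or_ne c 0 with rfl | hc0
  · left
    have h0 := (integral_eq_zero_iff_of_nonneg (fun x => (w x).2) hint).1 hc.symm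
    filter_upwards [h0] with x hx
    exact NNReal.coe_eq_zero.1 hx
  right
  have hfin : IsFiniteMeasure (circleMeasure.withDensity fun x => (w x : ℝ≥0∞)) := by
    simpa using isFiniteMeasure_withDensity_ofReal hint.2
  -- Finite measures are determined by integrals of continuous functions; the zero set of `w` is
  -- null for the left side, hence for `circleMeasure`, as `c ≠ 0`.
  have hmeasures : circleMeasure.withDensity (fun x => (w x : ℝ≥0∞)) = c • circleMeasure := by
    apply ext_of_forall_integral_eq_of_IsFiniteMeasure
    intro f
    rw [integral_withDensity_eq_integral_smul hmeas, integral_smul_nnreal_measure]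
    have := integral_continuousMap_mul_eq hint.ofReal h ⟨fun x => (f x : ℂ), by fun_prop⟩
    simp only [ContinuousMap.coe_mk, RCLike.ofReal_eq_complex_ofReal, ← Complex.ofReal_mul] at this
    rw [integral_complex_ofReal, integral_complex_ofReal, integral_complex_ofReal,
      ← Complex.ofReal_mul, Complex.ofReal_inj, ← hc] at this
    simp only [NNReal.smul_def, smul_eq_mul]
    rw [← this]
    simp only [mul_comm]
  have hnull : circleMeasure.withDensity (fun x => (w x : ℝ≥0∞)) {x | w x = 0} = 0 := by
    have hset : MeasurableSet {x | w x = 0} := hmeas (measurableSet_singleton 0)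
    rw [withDensity_apply _ hset, setLIntegral_congr_fun (g := fun _ => 0) hset
      fun x (hx : w x = 0) => by simp [hx]]
    simp
  rw [hmeasures, Measure.smul_apply, smul_eq_zero_iff_right hc0] at hnull
  rw [ae_iff]
  simpa only [not_not] using hnull

/-- A nonzero function in `L²` that is orthogonal to all its positive shifts is almost everywhere
nonzero. -/
theorem ae_ne_zero_of_inner_shift_eq_zero {h : LCircle 2} (hh : h ≠ 0)
    (horth : ∀ k : ℤ, 0 < k → inner ℂ h (mulOp (fourierLp ∞ k) h) = 0) :
    ∀ᵐ x ∂circleMeasure, h x ≠ 0 := by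
  have hfourier : ∀ k : ℤ, 0 < k →
      ∫ x, fourier k x * ((‖h x‖ ^ 2 : ℝ) : ℂ) ∂circleMeasure = 0 := by
    intro k hk
    rw [← horth k hk, L2.inner_def]
    apply integral_congr_ae
    filter_upwards [coeFn_mulOp_fourierLp k h] with x hx
    rw [hx, RCLike.inner_apply, mul_assoc, Complex.mul_conj, Complex.normSq_eq_norm_sq]
  have hfourier' : ∀ k : ℤ, k ≠ 0 →
      ∫ x, fourier k x * ((‖h x‖ ^ 2 : ℝ) : ℂ) ∂circleMeasure = 0 := by
    intro k hk
    rcases hk.lt_or_gt with hk | hk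
    -- `|h|²` is real, so its coefficients at `k` and `-k` are conjugate.
    · have := congrArg (starRingEnd ℂ) (hfourier (-k) (by lia))
      rw [← integral_conj, map_zero] at this
      simpa only [map_mul, fourier_neg, Complex.conj_conj, Complex.conj_ofReal] using this
    · exact hfourier k hk
  rcases ae_eq_zero_or_ae_ne_zero (w := fun x => ‖h x‖₊ ^ 2)
    ((Lp.stronglyMeasurable h).measurable.nnnorm.pow_const 2)
    (by simpa using (Lp.memLp h).integrable_norm_pow two_ne_zero) (by simpa using hfourier')
    with h0 | h0
  · refine absurd (Lp.ext ?_) hh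
    filter_upwards [h0, Lp.coeFn_zero ℂ 2 circleMeasure] with x hx hz
    rw [hz]
    simpa using hx
  · filter_upwards [h0] with x hx
    simpa using hx

/-! ### Injectivity on the Hardy space -/

theorem eq_zero_of_mulOp_eq_zero_of_ae_ne_zero {φ : LCircle ∞} {h : LCircle 2}
    (hφh : mulOp φ h = 0) (hne : ∀ᵐ x ∂circleMeasure, h x ≠ 0) : φ = 0 := by
  apply Lp.ext
  have hzero := coeFn_mulOp φ h
  rw [hφh] at hzero
  filter_upwards [hne, hzero, Lp.coeFn_zero ℂ 2 circleMeasure, Lp.coeFn_zero ℂ ∞ circleMeasure]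
    with x h1 h2 h3 h4
  rw [h4]
  rw [h3] at h2
  simpa [h1] using h2.symm

/-- Multiplication by a nonzero `φ ∈ L^∞` is injective on `H²`. -/
theorem eq_zero_of_mulOp_eq_zero {φ : LCircle ∞} (hφ : φ ≠ 0) {f : LCircle 2}
    (hf : f ∈ hardyH2) (hφf : mulOp φ f = 0) : f = 0 := by
  by_contra hf0
  let M : Submodule ℂ (LCircle 2) := hardyH2 ⊓ LinearMap.ker (mulOp φ)
  have hMclosed : IsClosed (M : Set (LCircle 2)) :=
    isClosed_hardyH2.inter (isClosed_singleton.preimage (continuous_mulOp φ))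
  have : CompleteSpace M := hMclosed.completeSpace_coe
  have hshift : ∀ g ∈ M, ∀ k : ℤ, 0 ≤ k → mulOp (fourierLp ∞ k) g ∈ M := fun g hg k hk =>
    ⟨mulOp_fourierLp_mem_hardyH2 hg.1 hk, by
      change mulOp φ (mulOp _ g) = 0
      rw [mulOp_comm, LinearMap.mem_ker.1 hg.2, map_zero]⟩
  -- `n` is the lowest frequency occurring in `M`.
  obtain ⟨n, ⟨g, hg, hgn⟩, hmin⟩ := Int.exists_least_of_bdd
    (P := fun n => ∃ g ∈ M, fourierCoeff g n ≠ 0)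
    ⟨0, fun n ⟨g, hg, hgn⟩ => not_lt.1 fun hn => hgn (hg.1 n hn)⟩
    (by
      by_contra! h
      exact hf0 (eq_zero_of_fourierCoeff_eq_zero fun n => h n f ⟨hf, hφf⟩))
  -- `h` represents the `n`-th coefficient functional on `M`. Shifting `h` up by `k > 0` puts its
  -- coefficient at `n - k` in place `n`, and that is zero by minimality.
  let h : LCircle 2 := M.starProjection (fourierLp 2 n)
  have hhM : h ∈ M := Submodule.starProjection_apply_mem M _
  have hinner : ∀ u ∈ M, inner ℂ h u = fourierCoeff u n := by
    intro u hu
    rw [fourierCoeff_eq_inner, Submodule.inner_starProjection_left_eq_right,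
      Submodule.starProjection_eq_self_iff.2 hu]
  have hh0 : h ≠ 0 := fun h0 => hgn (by rw [← hinner g hg, h0, inner_zero_left])
  refine hφ (eq_zero_of_mulOp_eq_zero_of_ae_ne_zero (LinearMap.mem_ker.1 hhM.2)
    (ae_ne_zero_of_inner_shift_eq_zero hh0 fun k hk => ?_))
  rw [hinner _ (hshift h hhM k hk.le), fourierCoeff_mulOp_fourierLp]
  by_contra hne
  have := hmin _ ⟨h, hhM, hne⟩
  lia

/-! ### From a lower bound to invertibility -/

theorem exists_shift_mem_hardyH2 {p : LCircle 2}
    (hp : p ∈ Submodule.span ℂ (Set.range (fourierLp (T := 2 * π) 2))) :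
    ∃ k : ℤ, mulOp (fourierLp ∞ k) p ∈ hardyH2 := by
  -- Asking for all large shifts lets a sum use one shift for both terms.
  suffices ∃ k : ℤ, ∀ j, k ≤ j → mulOp (fourierLp ∞ j) p ∈ hardyH2 from
    this.imp fun k hk => hk k le_rfl
  induction hp using Submodule.span_induction with
  | mem g hg =>
    obtain ⟨m, rfl⟩ := hg
    refine ⟨-m, fun j hj n hn => ?_⟩
    rw [fourierCoeff_mulOp_fourierLp, fourierCoeff_eq_inner]
    exact orthonormal_fourier.2 (by lia)
  | zero => exact ⟨0, fun j _ => by rw [map_zero]; exact zero_mem _⟩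
  | add f g _ _ hf hg =>
    obtain ⟨a, ha⟩ := hf
    obtain ⟨b, hb⟩ := hg
    refine ⟨max a b, fun j hj => ?_⟩
    rw [map_add]
    exact add_mem (ha j (le_of_max_le_left hj)) (hb j (le_of_max_le_right hj))
  | smul c f _ hf =>
    obtain ⟨a, ha⟩ := hf
    refine ⟨a, fun j hj => ?_⟩
    rw [map_smul]
    exact Submodule.smul_mem _ _ (ha j hj)

/-- If multiplication by `φ` is bounded below on `H²`, then it is bounded below on `L²`. -/
theorem norm_le_mul_norm_mulOp_of_hardyH2 {φ : LCircle ∞} {K : ℝ}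
    (hK : ∀ f ∈ hardyH2, ‖f‖ ≤ K * ‖mulOp φ f‖) (f : LCircle 2) : ‖f‖ ≤ K * ‖mulOp φ f‖ := by
  have hf : f ∈ (Submodule.span ℂ (Set.range (fourierLp (T := 2 * π) 2))).topologicalClosure := by
    rw [span_fourierLp_closure_eq_top (by simp)]; trivial
  refine closure_minimal (t := {f : LCircle 2 | ‖f‖ ≤ K * ‖mulOp φ f‖}) ?_ ?_ hf
  · intro p hp
    obtain ⟨k, hk⟩ := exists_shift_mem_hardyH2 hp
    have := hK _ hk
    rwa [mulOp_comm, norm_mulOp_fourierLp, norm_mulOp_fourierLp] at this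
  · exact isClosed_le continuous_norm (continuous_const.mul (continuous_mulOp φ).norm)

/-- If multiplication by `φ` is bounded below on `L²`, then `|φ|` is bounded below. -/
theorem ae_le_norm_of_norm_le_mul_norm_mulOp {φ : LCircle ∞} {K : ℝ} (hK0 : 0 < K)
    (hK : ∀ f : LCircle 2, ‖f‖ ≤ K * ‖mulOp φ f‖) :
    ∀ᵐ x ∂circleMeasure, (2 * K)⁻¹ ≤ ‖φ x‖ := by
  -- The factor 2 yields `‖u‖ ≤ ‖u‖ / 2` for the indicator `u` of `A`, so `A` is null.
  let A : Set (AddCircle (2 * π)) := {x | ‖φ x‖ < (2 * K)⁻¹}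
  have hA : MeasurableSet A :=
    measurableSet_lt (Lp.stronglyMeasurable φ).measurable.norm measurable_const
  let u : LCircle 2 := indicatorConstLp 2 hA (measure_ne_top _ _) 1
  have hu : ‖mulOp φ u‖ ≤ (2 * K)⁻¹ * ‖u‖ := by
    apply Lp.norm_le_mul_norm_of_ae_le_mul
    filter_upwards [coeFn_mulOp φ u,
      indicatorConstLp_coeFn (p := 2) (hs := hA) (hμs := measure_ne_top circleMeasure A)
        (c := (1 : ℂ))] with x h1 h2
    rw [h1, norm_mul, show u x = _ from h2]
    by_cases hx : x ∈ A
    · gcongr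
      exact hx.le
    · simp [hx]
  have hu0 : u = 0 := by
    rw [← norm_le_zero_iff]
    have h1 : K * ‖mulOp φ u‖ ≤ K * ((2 * K)⁻¹ * ‖u‖) := by gcongr
    have h2 : K * ((2 * K)⁻¹ * ‖u‖) = ‖u‖ / 2 := by field_simp
    linarith [hK u]
  have hA0 : circleMeasure A = 0 := by
    rw [← norm_eq_zero, norm_indicatorConstLp (by simp) (by simp)] at hu0
    have : circleMeasure.real A = 0 := by simpa using hu0
    exact (measureReal_eq_zero_iff (measure_ne_top _ _)).1 this
  rw [ae_iff]
  simpa only [not_le] using hA0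

theorem isInvertibleLInfty_of_ae_le_norm {φ : LCircle ∞} {c : ℝ} (hc : 0 < c)
    (h : ∀ᵐ x ∂circleMeasure, c ≤ ‖φ x‖) : IsInvertibleLInfty φ := by
  have hmem : MemLp (fun x => (φ x)⁻¹) ∞ circleMeasure := by
    refine memLp_top_of_bound
      (Lp.stronglyMeasurable φ).measurable.inv.aestronglyMeasurable c⁻¹ ?_
    filter_upwards [h] with x hx
    rw [norm_inv]
    gcongr
  refine ⟨hmem.toLp, ?_⟩
  apply AEEqFun.ext
  filter_upwards [h, hmem.coeFn_toLp,
    AEEqFun.coeFn_mul (φ : AddCircle (2 * π) →ₘ[circleMeasure] ℂ) hmem.toLp,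
    AEEqFun.coeFn_one (α := AddCircle (2 * π)) (β := ℂ) (μ := circleMeasure)] with x h1 h2 h3 h4
  rw [h3, h4, Pi.mul_apply, h2, Pi.one_apply, mul_inv_cancel₀]
  exact norm_pos_iff.1 (hc.trans_le h1)

theorem isInvertibleLInfty_of_isClosed {φ : LCircle ∞} (hφ : φ ≠ 0)
    (h : IsClosed (mulHardyH2 φ : Set (LCircle 2))) : IsInvertibleLInfty φ := by
  have : CompleteSpace hardyH2 := isClosed_hardyH2.completeSpace_coe
  let T : hardyH2 →L[ℂ] LCircle 2 :=
    ⟨(mulOp φ).comp hardyH2.subtype, (continuous_mulOp φ).comp continuous_subtype_val⟩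
  have hinj : Function.Injective T := by
    rw [injective_iff_map_eq_zero]
    exact fun f hf => Subtype.ext (eq_zero_of_mulOp_eq_zero hφ f.2 hf)
  have hrange : Set.range T = mulHardyH2 φ := by
    ext g
    simp [T, mulHardyH2]
  obtain ⟨K, hK⟩ := T.antilipschitz_of_injective_of_isClosed_range hinj (hrange ▸ h)
  -- `K` may be zero; `K + 1` is a positive constant.
  have hbound : ∀ f ∈ hardyH2, ‖f‖ ≤ ((K : ℝ) + 1) * ‖mulOp φ f‖ := fun f hf => by
    have : ‖f‖ ≤ K * ‖mulOp φ f‖ := T.bound_of_antilipschitz hK ⟨f, hf⟩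
    linarith [norm_nonneg (mulOp φ f)]
  have hK0 : (0 : ℝ) < K + 1 := by positivity
  exact isInvertibleLInfty_of_ae_le_norm (c := (2 * ((K : ℝ) + 1))⁻¹) (by positivity)
    (ae_le_norm_of_norm_le_mul_norm_mulOp hK0 (norm_le_mul_norm_mulOp_of_hardyH2 hbound))

theorem isClosed_of_isInvertibleLInfty {φ : LCircle ∞} (h : IsInvertibleLInfty φ) :
    IsClosed (mulHardyH2 φ : Set (LCircle 2)) := by
  obtain ⟨ψ, hψ⟩ := h
  have hinv : ∀ f : LCircle 2, mulOp φ (mulOp ψ f) = f := by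
    intro f
    apply Lp.ext
    have h1 := AEEqFun.coeFn_mul (φ : AddCircle (2 * π) →ₘ[circleMeasure] ℂ) ψ
    rw [hψ] at h1
    filter_upwards [coeFn_mulOp φ (mulOp ψ f), coeFn_mulOp ψ f, h1,
      AEEqFun.coeFn_one (α := AddCircle (2 * π)) (β := ℂ) (μ := circleMeasure)] with x h2 h3 h4 h5
    rw [h5] at h4
    rw [h2, h3, ← mul_assoc, show φ x * ψ x = 1 from h4.symm, one_mul]
  have : (mulHardyH2 φ : Set (LCircle 2)) = mulOp ψ ⁻¹' hardyH2 := by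
    ext g
    constructor
    · rintro ⟨f, hf, rfl⟩
      rw [Set.mem_preimage, mulOp_comm, hinv]
      exact hf
    · exact fun hg => ⟨mulOp ψ g, hg, hinv g⟩
  rw [this]
  exact isClosed_hardyH2.preimage (continuous_mulOp ψ)

theorem mainTheorem7 (φ : LCircle ∞) (hφ : φ ≠ 0) :
    IsClosed (mulHardyH2 φ : Set (LCircle 2)) ↔ IsInvertibleLInfty φ :=
  ⟨isInvertibleLInfty_of_isClosed hφ, isClosed_of_isInvertibleLInfty⟩
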